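/- **Setting.** Let $q,K\in\mathbb N$ with $K\ge 2q+1$, let $\mathcal Y=\{0,1\}^K$, let $\mathcal B(y,q)=\{z\in\mathcal Y:\ z \text{ and } y \text{ differ in at most } q \text{ coordinates}\}$ be the Hamming ball, and let $\mathcal S=\{\mathcal B(y,q): y\in\mathcal Y\}$. Let $\mathcal X$ be a non-empty instance space and $\mathcal H\subseteq\mathcal Y^{\mathcal X}$ a non-empty hypothesis class. A (randomized) online learner is a map $\mathcal A$ that sends the list of past examples in $\mathcal X\times\mathcal S$ and the current instance $x_t$ to a probability distribution on $\mathcal Y$, from which its label $\hat y_t$ is drawn (independently over the rounds); it may depend on the horizon $T$. It suffers the loss $\mathbb 1\{\hat y_t\notin S_t\}$, i.e. the thresholded Hamming loss. A stream $(x_t,S_t)_{t\le T}$ is realizable if some $h\in\mathcal H$ has $h(x_t)\in S_t$ for all $t$. Put $$\mathtt M_{\mathcal A}(T,\mathcal H)=\sup_{\text{realizable streams}}\mathbb E\Big[\sum_{t=1}^T\mathbb 1\{\hat y_t\notin S_t\}\Big],\qquad \mathtt R_{\mathcal A}(T,\mathcal H)=\sup_{\text{all streams}}\mathbb E\Big[\sum_{t=1}^T\mathbb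 1\{\hat y_t\notin S_t\}-\inf_{h\in\mathcal H}\sum_{t=1}^T\mathbb 1\{h(x_t)\notin S_t\}\Big].$$ **Dimensions.** For a set $M$, an $\mathcal X$-valued $M$-ary tree of depth $d$ with edges labeled by $\mathcal S$ consists of maps $\mathcal T_t:M^{t-1}\to\mathcal X$ and $f_t:M^t\to\mathcal S$ for $1\le t\le d$. The Set Littlestone dimension $\mathtt{SL}(\mathcal H)\in\mathbb N\cup\{\infty\}$ is the supremum of the depths $d$ for which there is such a tree with $M=\mathcal Y$ such that for every path $y\in\mathcal Y^d$ we have $y_t\notin f_t(y_{\le t})$ for all $t\le d$ and some $h\in\mathcal H$ satisfies $h(\mathcal T_t(y_{<t}))\in f_t(y_{\le t})$ for all $t\le d$. The 2-Set Littlestone dimension $\mathtt{SL}_2(\mathcal H)\in\mathbb N\cup\{\infty\}$ is the supremum of the depths $d$ for which there is such a tree with $M=\{1,2\}$ such that for every path $m\in\{1,2\}^d$ we have $f_t(m_{<t},1)\cap f_t(m_{<t},2)=\emptyset$ for all $t\le d$ and some $h\in\mathcal H$ satisfies $h(\mathcal T_t(m_{<t}))\in f_t(m_{\le t})$ for all $t\le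 d$. **Corollary (Quantitative Online Learnability of Multilabel Classification).** For every horizon $T\in\mathbb N$, in the realizable setting, $$\frac{\min\{\mathtt{SL}_2(\mathcal H),\,T\}}{2}\ \le\ \inf_{\mathcal A}\mathtt M_{\mathcal A}(T,\mathcal H)\ \le\ \mathtt{SL}(\mathcal H),$$ and in the agnostic setting, $$\sqrt{\frac{\min\{\mathtt{SL}_2(\mathcal H),\,2T\}\;T}{8}}\ \le\ \inf_{\mathcal A}\mathtt R_{\mathcal A}(T,\mathcal H)\ \le\ \mathtt{SL}(\mathcal H)+\sqrt{2\,\mathtt{SL}(\mathcal H)\,T\ln T},$$ where the infima are over all randomized learners, and $\infty\cdot 0=0$ and $T\ln T=0$ for $T=0$. In particular, if $T\ge\mathtt{SL}_2(\mathcal H)$, the lower bounds are $\mathtt{SL}_2(\mathcal H)/2$ and $\sqrt{\mathtt{SL}_2(\mathcal H)\,T/8}$. -/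

import Mathlib

open MeasureTheory
open scoped ENNReal

/-! ### Online learning with set-valued feedback

Throughout, `X` is the instance space, `Y` the label space, `S : Set (Set Y)` the collection of sets
that can be revealed as feedback, and `H : Set (X → Y)` the hypothesis class. -/

/-- A randomized online learner: a deterministic map sending the list of past labeled examples and
the new instance to a probability distribution over the labels. -/
abbrev RandomizedLearner (X Y : Type*) [MeasurableSpace Y] (S : Set (Set Y)) : Type _ :=
  List (X × S) → X → ProbabilityMeasure Y

namespace RandomizedLearner

variable {X Y : Type*} [MeasurableSpace Y] {S : Set (Set Y)} {T : ℕ}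

/-- The distribution from which the learner draws its label in round `t` on the stream `s`; it
depends on the examples of the earlier rounds and on the instance of round `t`. -/
def prediction (A : RandomizedLearner X Y S) (s : Fin T → X × S) (t : Fin T) :
    ProbabilityMeasure Y :=
  A (List.ofFn (Fin.take (t : ℕ) t.is_lt.le s)) (s t).1

/-- The joint law of the labels drawn in rounds `1, …, T` on the stream `s`. -/
noncomputable def law (A : RandomizedLearner X Y S) (s : Fin T → X × S) : Measure (Fin T → Y) :=
  Measure.pi fun t => (A.prediction s t : Measure Y)

end RandomizedLearner

open Classical in
/-- The cumulative loss `∑ₜ 1{yₜ ∉ Sₜ}` of the labels `y` on the stream `s`. -/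
noncomputable def cumulativeLoss {X Y : Type*} {S : Set (Set Y)} {T : ℕ} (s : Fin T → X × S)
    (y : Fin T → Y) : ℝ :=
  ∑ t, if y t ∈ ((s t).2 : Set Y) then 0 else 1

/-- The stream `s` is realizable by `H`. -/
def IsRealizable {X Y : Type*} {S : Set (Set Y)} (H : Set (X → Y)) {T : ℕ}
    (s : Fin T → X × S) : Prop :=
  ∃ h ∈ H, ∀ t, h (s t).1 ∈ ((s t).2 : Set Y)

/-- The cumulative loss of the best hypothesis of `H` in hindsight on the stream `s`. -/
noncomputable def bestLoss {X Y : Type*} {S : Set (Set Y)} (H : Set (X → Y)) {T : ℕ}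
    (s : Fin T → X × S) : ℝ :=
  ⨅ h : H, cumulativeLoss s fun t => (h : X → Y) (s t).1

/-- `M_A(T, H)`: the worst-case expected number of mistakes of `A` over all realizable streams of
length `T`. -/
noncomputable def expectedMistakes {X Y : Type*} [MeasurableSpace Y] {S : Set (Set Y)}
    (H : Set (X → Y)) (T : ℕ) (A : RandomizedLearner X Y S) : EReal :=
  ⨆ (s : Fin T → X × S) (_ : IsRealizable H s), ((∫ y, cumulativeLoss s y ∂(A.law s) : ℝ) : EReal)

/-- `R_A(T, H)`: the worst-case expected regret of `A` over all streams of length `T`. -/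
noncomputable def expectedRegret {X Y : Type*} [MeasurableSpace Y] {S : Set (Set Y)}
    (H : Set (X → Y)) (T : ℕ) (A : RandomizedLearner X Y S) : EReal :=
  ⨆ s : Fin T → X × S, ((∫ y, (cumulativeLoss s y - bestLoss H s) ∂(A.law s) : ℝ) : EReal)

/-- The infimum of `M_A(T, H)` over all randomized learners `A`. -/
noncomputable def minimaxMistakes {X Y : Type*} [MeasurableSpace Y] (S : Set (Set Y))
    (H : Set (X → Y)) (T : ℕ) : EReal :=
  ⨅ A : RandomizedLearner X Y S, expectedMistakes H T A

/-- The infimum of `R_A(T, H)` over all randomized learners `A`. -/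
noncomputable def minimaxRegret {X Y : Type*} [MeasurableSpace Y] (S : Set (Set Y))
    (H : Set (X → Y)) (T : ℕ) : EReal :=
  ⨅ A : RandomizedLearner X Y S, expectedRegret H T A

/-! ### Trees and combinatorial dimensions -/

/-- A complete `X`-valued, `M`-ary tree of depth `d`: at each level `t`, the function labeling
the node reached by a path of `t` edges (levels are counted from `0`). -/
abbrev LabeledTree (X M : Type*) (d : ℕ) : Type _ := (t : Fin d) → (Fin (t : ℕ) → M) → X

/-- Labels in `N` for the edges of an `M`-ary tree of depth `d`: at each level `t`, the function
labeling the last edge of a path of `t + 1` edges. -/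
abbrev EdgeLabeling (M N : Type*) (d : ℕ) : Type _ := (t : Fin d) → (Fin ((t : ℕ) + 1) → M) → N

/-- The path `m` runs through nodes and edges that are consistent with the hypothesis `h`. -/
def FollowsPath {X Y M : Type*} {S : Set (Set Y)} {d : ℕ} (tree : LabeledTree X M d)
    (f : EdgeLabeling M S d) (m : Fin d → M) (h : X → Y) : Prop :=
  ∀ t : Fin d, h (tree t (Fin.take (t : ℕ) t.is_lt.le m)) ∈
    (f t (Fin.take ((t : ℕ) + 1) t.is_lt m) : Set Y)

/-- The `Y`-ary tree is shattered by `H` in the sense of the Set Littlestone dimension. -/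
def IsSetShattered {X Y : Type*} (S : Set (Set Y)) (H : Set (X → Y)) {d : ℕ}
    (tree : LabeledTree X Y d) : Prop :=
  ∃ f : EdgeLabeling Y S d, ∀ y : Fin d → Y,
    (∀ t : Fin d, y t ∉ (f t (Fin.take ((t : ℕ) + 1) t.is_lt y) : Set Y)) ∧
    ∃ h ∈ H, FollowsPath tree f y h

/-- The Set Littlestone dimension `SL(H)`. -/
noncomputable def setLittlestoneDim {X Y : Type*} (S : Set (Set Y)) (H : Set (X → Y)) : ℕ∞ :=
  ⨆ (d : ℕ) (_ : ∃ tree : LabeledTree X Y d, IsSetShattered S H tree), (d : ℕ∞)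

/-- The `p`-ary tree is shattered by `H` in the sense of the `p`-Set Littlestone dimension. -/
def IsPSetShattered {X Y : Type*} (p : ℕ) (S : Set (Set Y)) (H : Set (X → Y)) {d : ℕ}
    (tree : LabeledTree X (Fin p) d) : Prop :=
  ∃ f : EdgeLabeling (Fin p) S d, ∀ m : Fin d → Fin p,
    (∀ t : Fin d, ⋂ i : Fin p,
      (f t (Fin.snoc (α := fun _ => Fin p) (Fin.take (t : ℕ) t.is_lt.le m) i) : Set Y) = ∅) ∧
    ∃ h ∈ H, FollowsPath tree f m h

/-- The `p`-Set Littlestone dimension `SL_p(H)`. -/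
noncomputable def pSetLittlestoneDim {X Y : Type*} (p : ℕ) (S : Set (Set Y)) (H : Set (X → Y)) :
    ℕ∞ :=
  ⨆ (d : ℕ) (_ : ∃ tree : LabeledTree X (Fin p) d, IsPSetShattered p S H tree), (d : ℕ∞)

/-! ### Multilabel classification with thresholded Hamming loss -/

/-- The Hamming ball of radius `q` centered at `y` in `{0, 1}^K`. -/
def hammingBall {K : ℕ} (y : Fin K → Bool) (q : ℕ) : Set (Fin K → Bool) :=
  {z | hammingDist z y ≤ q}

/-- The set system of all Hamming balls of radius `q` in `{0, 1}^K`. -/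
def hammingBalls (K q : ℕ) : Set (Set (Fin K → Bool)) :=
  Set.range fun y : Fin K → Bool => hammingBall y q

/-! Both dimensions are unfolded into recursions on the version space (`SetShatters`,
`PairShatters`), so every argument is an induction on depth or on the list of examples.

Lower bounds: two disjoint sets have error probabilities summing to at least 1, so an adversary
descending a shattered binary tree forces an expected loss of 1/2 per level. In the agnostic case
each node is repeated for a block of `k` rounds. By averaging, some choice of sets does at least as
well as fair coin flips (`exists_block`), and descending to the majority set gains half the expected
distance of a `k`-step random walk. Splitting `T` into nearly equal blocks and bounding this
distance by central binomial coefficients (`sqrt_le_add_absWalk`) gives the square root with its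
constant.

Upper bounds: without a shattered tree of depth `d + 1`, some label makes every mistake cost one
unit of dimension (`not_setShatters_restrict`), so the optimal algorithm errs at most `d` times on
realizable streams. In the agnostic case, let the algorithm update only in prescribed rounds. At
most `d` well-chosen rounds suffice to compete with a given hypothesis up to `d` extra mistakes
(`exists_lazyLoss_le`). Exponential weights over the `T ^ d` choices of rounds (`cumErr_hedge_le`),
with a tuned rate, complete the bound. -/

/-! ### Shattering as a recursion on the depth -/

section Shattering

variable {X Y : Type*} {S : Set (Set Y)}

/-- The hypotheses of `V` that are consistent with the example `e`. -/
def restrict (V : Set (X → Y)) (e : X × S) : Set (X → Y) :=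
  {h | h ∈ V ∧ h e.1 ∈ (e.2 : Set Y)}

theorem restrict_subset (V : Set (X → Y)) (e : X × S) : restrict V e ⊆ V := fun _ h => h.1

theorem restrict_mono {V W : Set (X → Y)} (hVW : V ⊆ W) (e : X × S) :
    restrict V e ⊆ restrict W e := fun _ h => ⟨hVW h.1, h.2⟩

/-- Recursive form of the existence of a shattered tree of depth `d` for the Set Littlestone
dimension. -/
def SetShatters (S : Set (Set Y)) : ℕ → Set (X → Y) → Prop
  | 0, V => V.Nonempty
  | d + 1, V => ∃ x : X, ∀ y : Y, ∃ s : S, y ∉ (s : Set Y) ∧ SetShatters S d (restrict V (x, s))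

/-- Recursive form of the existence of a shattered tree of depth `d` for the 2-Set Littlestone
dimension. -/
def PairShatters (S : Set (Set Y)) : ℕ → Set (X → Y) → Prop
  | 0, V => V.Nonempty
  | d + 1, V => ∃ (x : X) (s₁ s₂ : S), (s₁ : Set Y) ∩ s₂ = ∅ ∧
      PairShatters S d (restrict V (x, s₁)) ∧ PairShatters S d (restrict V (x, s₂))

theorem SetShatters.mono {d : ℕ} {V W : Set (X → Y)} (hVW : V ⊆ W) (h : SetShatters S d V) :
    SetShatters S d W := by
  induction d generalizing V W with
  | zero => exact Set.Nonempty.mono hVW h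
  | succ d ih =>
    obtain ⟨x, hx⟩ := h
    refine ⟨x, fun y => ?_⟩
    obtain ⟨s, hs, h⟩ := hx y
    exact ⟨s, hs, ih (restrict_mono hVW _) h⟩

theorem SetShatters.of_succ [Nonempty Y] {d : ℕ} {V : Set (X → Y)}
    (h : SetShatters S (d + 1) V) : SetShatters S d V := by
  induction d generalizing V with
  | zero =>
    obtain ⟨x, hx⟩ := h
    obtain ⟨s, -, h⟩ := hx (Classical.arbitrary Y)
    exact Set.Nonempty.mono (restrict_subset _ _) h
  | succ d ih =>
    obtain ⟨x, hx⟩ := h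
    refine ⟨x, fun y => ?_⟩
    obtain ⟨s, hs, h⟩ := hx y
    exact ⟨s, hs, ih h⟩

theorem SetShatters.of_le [Nonempty Y] {d n : ℕ} (hdn : d ≤ n) {V : Set (X → Y)}
    (h : SetShatters S n V) : SetShatters S d V := by
  induction n, hdn using Nat.le_induction with
  | base => exact h
  | succ n _ ih => exact ih h.of_succ

theorem PairShatters.of_succ {d : ℕ} {V : Set (X → Y)}
    (h : PairShatters S (d + 1) V) : PairShatters S d V := by
  induction d generalizing V with
  | zero =>
    obtain ⟨x, s₁, s₂, -, h, -⟩ := h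
    exact Set.Nonempty.mono (restrict_subset _ _) h
  | succ d ih =>
    obtain ⟨x, s₁, s₂, h, h₁, h₂⟩ := h
    exact ⟨x, s₁, s₂, h, ih h₁, ih h₂⟩

theorem PairShatters.of_le {d n : ℕ} (hdn : d ≤ n) {V : Set (X → Y)}
    (h : PairShatters S n V) : PairShatters S d V := by
  induction n, hdn using Nat.le_induction with
  | base => exact h
  | succ n _ ih => exact ih h.of_succ

theorem take_succ_cons {M : Type*} {d : ℕ} (a : M) (m : Fin d → M) (t : ℕ) (ht : t ≤ d) :
    Fin.take (α := fun _ => M) (t + 1) (Nat.succ_le_succ ht)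
        (Fin.cons (α := fun _ => M) a m) =
      Fin.cons (α := fun _ => M) a (Fin.take (α := fun _ => M) t ht m) := by
  funext i
  refine Fin.cases rfl (fun j => rfl) i

/-- The subtrees chosen for each root label are glued together: the first edge of a path selects the
subtree. -/
theorem SetShatters.exists_tree {d : ℕ} {V : Set (X → Y)} (h : SetShatters S d V) :
    ∃ tree : LabeledTree X Y d, IsSetShattered S V tree := by
  induction d generalizing V with
  | zero =>
    obtain ⟨h, hh⟩ := h
    exact ⟨fun t => t.elim0, fun t => t.elim0, fun y => ⟨fun t => t.elim0, h, hh, fun t => t.elim0⟩⟩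
  | succ d ih =>
    obtain ⟨x, hx⟩ := h
    choose s hs hsh using hx
    choose tree f hf using fun y => ih (hsh y)
    refine ⟨fun t => Fin.cases (motive := fun t => (Fin (t : ℕ) → Y) → X) (fun _ => x)
      (fun t (m : Fin ((t : ℕ) + 1) → Y) => tree (m 0) t fun j => m j.succ) t,
      fun t => Fin.cases (motive := fun t => (Fin ((t : ℕ) + 1) → Y) → S) (fun m => s (m 0))
      (fun t (m : Fin ((t : ℕ) + 1 + 1) → Y) => f (m 0) t fun j => m j.succ) t, fun y => ⟨fun t => ?_, ?_⟩⟩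
    · refine Fin.cases ?_ (fun t => ?_) t
      · exact hs (y 0)
      · exact (hf (y 0) (Fin.tail y)).1 t
    · obtain ⟨h, hh, hp⟩ := (hf (y 0) (Fin.tail y)).2
      refine ⟨h, hh.1, fun t => ?_⟩
      refine Fin.cases ?_ (fun t => ?_) t
      · exact hh.2
      · exact hp t

theorem IsPSetShattered.pairShatters {d : ℕ} {V : Set (X → Y)} {tree : LabeledTree X (Fin 2) d}
    (h : IsPSetShattered 2 S V tree) : PairShatters S d V := by
  induction d generalizing V with
  | zero =>
    obtain ⟨f, hf⟩ := h
    obtain ⟨-, h, hh, -⟩ := hf fun t => t.elim0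
    exact ⟨h, hh⟩
  | succ d ih =>
    obtain ⟨f, hf⟩ := h
    -- The subtree below edge `i` is read off by prefixing every path with `i`.
    have key : ∀ i : Fin 2, PairShatters S d
        (restrict V (tree 0 (fun t => t.elim0), f 0 (fun _ => i))) := by
      intro i
      refine ih (tree := fun t m => tree t.succ (Fin.cons (α := fun _ => Fin 2) i m))
        ⟨fun t m => f t.succ (Fin.cons (α := fun _ => Fin 2) i m), fun m => ⟨fun t => ?_, ?_⟩⟩
      · rw [← (hf (Fin.cons (α := fun _ => Fin 2) i m)).1 t.succ]
        refine Set.iInter_congr fun j => congrArg (fun p => (f t.succ p : Set Y)) ?_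
        exact (Fin.cons_snoc_eq_snoc_cons i _ j).trans
          (congrArg (fun p => Fin.snoc (α := fun _ => Fin 2) p j)
            (take_succ_cons i m t t.is_lt.le).symm)
      · obtain ⟨h, hh, hp⟩ := (hf (Fin.cons (α := fun _ => Fin 2) i m)).2
        refine ⟨h, ⟨hh, ?_⟩, fun t => ?_⟩
        · convert hp 0 using 3
          · funext j
            obtain rfl : j = 0 := Subsingleton.elim (α := Fin 1) j 0
            rfl
          · funext j; exact (show Fin 0 from j).elim0
        · convert hp t.succ using 3
          · exact (take_succ_cons i m (t + 1) t.is_lt).symm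
          · exact (take_succ_cons i m t t.is_lt.le).symm
    refine ⟨tree 0 (fun t => t.elim0), f 0 (fun _ => 0), f 0 (fun _ => 1), ?_, key 0, key 1⟩
    have := (hf (fun _ => 0)).1 0
    rw [← this]
    ext y
    simp only [Set.mem_inter_iff, Set.mem_iInter, Fin.forall_fin_two]
    refine and_congr (iff_of_eq ?_) (iff_of_eq ?_) <;> congr 3

theorem not_setShatters_of_setLittlestoneDim {V : Set (X → Y)} {d : ℕ}
    (h : setLittlestoneDim S V = d) : ¬ SetShatters S (d + 1) V := by
  intro hs
  have : ((d + 1 : ℕ) : ℕ∞) ≤ setLittlestoneDim S V :=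
    le_iSup₂_of_le (d + 1) hs.exists_tree le_rfl
  rw [h, Nat.cast_le] at this
  omega

theorem pairShatters_of_le_pSetLittlestoneDim {V : Set (X → Y)} (hV : V.Nonempty) {d : ℕ}
    (h : (d : ℕ∞) ≤ pSetLittlestoneDim 2 S V) : PairShatters S d V := by
  rcases d with _ | d
  · exact hV
  -- The strict inequality yields a deeper or equally deep tree without assuming that the supremum
  -- is finite or attained.
  have h' : (d : ℕ∞) < pSetLittlestoneDim 2 S V :=
    lt_of_lt_of_le (by exact_mod_cast Nat.lt_succ_self d) h
  simp only [pSetLittlestoneDim, lt_iSup_iff] at h'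
  obtain ⟨n, ⟨tree, ht⟩, hn⟩ := h'
  exact ht.pairShatters.of_le (by exact_mod_cast hn)

end Shattering

/-! ### Losses along lists of examples -/

section Losses

variable {X Y : Type*} {S : Set (Set Y)}

open Classical in
/-- The zero-one loss of the label `y` on the set `s`. -/
noncomputable def miss (y : Y) (s : Set Y) : ℝ := if y ∈ s then 0 else 1

theorem miss_of_mem {y : Y} {s : Set Y} (h : y ∈ s) : miss y s = 0 := if_pos h

theorem miss_of_notMem {y : Y} {s : Set Y} (h : y ∉ s) : miss y s = 1 := if_neg h

theorem miss_nonneg (y : Y) (s : Set Y) : 0 ≤ miss y s := by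
  unfold miss; split_ifs <;> norm_num

theorem miss_le_one (y : Y) (s : Set Y) : miss y s ≤ 1 := by
  unfold miss; split_ifs <;> norm_num

/-- The number of mistakes of the hypothesis `h` on a list of examples. -/
noncomputable def hypLoss (h : X → Y) (l : List (X × S)) : ℝ :=
  (l.map fun e => miss (h e.1) e.2).sum

@[simp] theorem hypLoss_nil (h : X → Y) : hypLoss h ([] : List (X × S)) = 0 := rfl

@[simp] theorem hypLoss_cons (h : X → Y) (e : X × S) (l : List (X × S)) :
    hypLoss h (e :: l) = miss (h e.1) e.2 + hypLoss h l := by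
  simp [hypLoss]

theorem hypLoss_append (h : X → Y) (l l' : List (X × S)) :
    hypLoss h (l ++ l') = hypLoss h l + hypLoss h l' := by
  simp [hypLoss]

theorem hypLoss_nonneg (h : X → Y) (l : List (X × S)) : 0 ≤ hypLoss h l := by
  induction l with
  | nil => simp
  | cons e l ih => rw [hypLoss_cons]; linarith [miss_nonneg (h e.1) e.2]

theorem cumulativeLoss_eq_hypLoss {T : ℕ} (s : Fin T → X × S) (h : X → Y) :
    (cumulativeLoss s fun t => h (s t).1) = hypLoss h (List.ofFn s) := by
  simp only [hypLoss, List.map_ofFn, List.sum_ofFn]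
  rfl

theorem bestLoss_le {H : Set (X → Y)} {h : X → Y} (hh : h ∈ H) {T : ℕ} (s : Fin T → X × S) :
    bestLoss H s ≤ hypLoss h (List.ofFn s) := by
  rw [← cumulativeLoss_eq_hypLoss]
  refine ciInf_le (f := fun h : H => cumulativeLoss s fun t => (h : X → Y) (s t).1) ?_ ⟨h, hh⟩
  refine ⟨0, ?_⟩
  rintro _ ⟨g, rfl⟩
  exact (hypLoss_nonneg _ _).trans_eq (cumulativeLoss_eq_hypLoss s g).symm

theorem le_bestLoss {H : Set (X → Y)} (hH : H.Nonempty) {T : ℕ} {s : Fin T → X × S} {c : ℝ}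
    (hc : ∀ h ∈ H, c ≤ hypLoss h (List.ofFn s)) : c ≤ bestLoss H s := by
  have := hH.to_subtype
  exact le_ciInf fun h => (hc h h.2).trans_eq (cumulativeLoss_eq_hypLoss s h).symm

variable [MeasurableSpace Y]

namespace RandomizedLearner

/-- The probability that `A` errs on the example `e` after having seen the list `hist`. -/
noncomputable def err (A : RandomizedLearner X Y S) (hist : List (X × S)) (e : X × S) : ℝ :=
  (A hist e.1 : Measure Y).real (e.2 : Set Y)ᶜ

/-- The expected number of mistakes of `A` on a list of examples that follows the list `hist`. -/
noncomputable def cumErr (A : RandomizedLearner X Y S) : List (X × S) → List (X × S) → ℝ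
  | _, [] => 0
  | hist, e :: l => A.err hist e + cumErr A (hist ++ [e]) l

theorem err_nonneg (A : RandomizedLearner X Y S) (hist : List (X × S)) (e : X × S) :
    0 ≤ A.err hist e := measureReal_nonneg

theorem err_le_one (A : RandomizedLearner X Y S) (hist : List (X × S)) (e : X × S) :
    A.err hist e ≤ 1 := measureReal_le_one

theorem cumErr_nonneg (A : RandomizedLearner X Y S) (hist l : List (X × S)) :
    0 ≤ A.cumErr hist l := by
  induction l generalizing hist with
  | nil => exact le_rfl
  | cons e l ih => exact add_nonneg (A.err_nonneg _ _) (ih _)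

theorem cumErr_le_length (A : RandomizedLearner X Y S) (hist l : List (X × S)) :
    A.cumErr hist l ≤ l.length := by
  induction l generalizing hist with
  | nil => simp [cumErr]
  | cons e l ih =>
    have := ih (hist ++ [e])
    have := A.err_le_one hist e
    simp only [cumErr, List.length_cons]
    push_cast
    linarith

theorem cumErr_append (A : RandomizedLearner X Y S) (hist l l' : List (X × S)) :
    A.cumErr hist (l ++ l') = A.cumErr hist l + A.cumErr (hist ++ l) l' := by
  induction l generalizing hist with
  | nil => simp [cumErr]
  | cons e l ih => simp [cumErr, ih, add_assoc]

/-- The complements of disjoint sets cover the label space. -/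
theorem one_le_err_add_err (A : RandomizedLearner X Y S) (hist : List (X × S)) (x : X)
    {s₁ s₂ : S} (h : (s₁ : Set Y) ∩ s₂ = ∅) : 1 ≤ A.err hist (x, s₁) + A.err hist (x, s₂) := by
  have hu : (s₁ : Set Y)ᶜ ∪ (s₂ : Set Y)ᶜ = Set.univ := by
    rw [← Set.compl_inter, h, Set.compl_empty]
  have := measureReal_union_le (μ := (A hist x : Measure Y)) (s₁ : Set Y)ᶜ (s₂ : Set Y)ᶜ
  rw [hu, probReal_univ] at this
  exact this

theorem sum_err_eq_cumErr (A : RandomizedLearner X Y S) (hist : List (X × S)) {T : ℕ}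
    (s : Fin T → X × S) :
    ∑ t : Fin T, A.err (hist ++ List.ofFn (Fin.take (t : ℕ) t.is_lt.le s)) (s t) =
      A.cumErr hist (List.ofFn s) := by
  induction T generalizing hist with
  | zero => simp [cumErr]
  | succ T ih =>
    rw [Fin.sum_univ_succ, List.ofFn_succ, cumErr, ← ih]
    congr 1
    · simp [List.ofFn_zero]
    · refine Finset.sum_congr rfl fun t _ => ?_
      congr 1
      rw [List.append_assoc]
      congr 1
      exact List.ofFn_succ (f := Fin.take (α := fun _ => X × S) ((t : ℕ) + 1) t.succ.is_lt.le s)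

variable [Finite Y] [DiscreteMeasurableSpace Y]

/-- By linearity only the marginals of the product law matter; from here on expectations are
replaced by sums along lists. -/
theorem integral_cumulativeLoss (A : RandomizedLearner X Y S) {T : ℕ} (s : Fin T → X × S) :
    ∫ y, cumulativeLoss s y ∂(A.law s) = A.cumErr [] (List.ofFn s) := by
  have := Fintype.ofFinite Y
  have hprob : IsProbabilityMeasure (A.law s) := by unfold law; infer_instance
  rw [← sum_err_eq_cumErr]
  unfold cumulativeLoss
  rw [integral_finsetSum _ fun t _ => Integrable.of_finite]
  refine Finset.sum_congr rfl fun t _ => ?_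
  have hmp := measurePreserving_eval (fun t => (A.prediction s t : Measure Y)) t
  have hm : (fun y : Fin T → Y => miss (y t) ((s t).2 : Set Y)) =
      (fun y => miss y ((s t).2 : Set Y)) ∘ Function.eval t := rfl
  calc ∫ y, miss (y t) ((s t).2 : Set Y) ∂(A.law s)
      = ∫ y, miss y ((s t).2 : Set Y) ∂(A.prediction s t : Measure Y) := by
        rw [← hmp.map_eq, integral_map hmp.measurable.aemeasurable
          (measurable_of_finite _).aestronglyMeasurable]
        rfl
    _ = ∫ y, ((s t).2 : Set Y)ᶜ.indicator 1 y ∂(A.prediction s t : Measure Y) := by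
        congr 1; funext y
        by_cases hy : y ∈ ((s t).2 : Set Y) <;> simp [miss, hy]
    _ = _ := by
        rw [integral_indicator_one (Set.toFinite _).measurableSet]
        simp [err, prediction]

theorem integral_cumulativeLoss_sub (A : RandomizedLearner X Y S) {T : ℕ} (s : Fin T → X × S)
    (c : ℝ) :
    ∫ y, (cumulativeLoss s y - c) ∂(A.law s) = A.cumErr [] (List.ofFn s) - c := by
  have hprob : IsProbabilityMeasure (A.law s) := by unfold law; infer_instance
  rw [integral_sub Integrable.of_finite (integrable_const c), integral_cumulativeLoss]
  simp

end RandomizedLearner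

theorem exists_ofFn_eq {α : Type*} {l : List α} {T : ℕ} (hl : l.length = T) :
    ∃ s : Fin T → α, List.ofFn s = l := by
  subst hl
  exact ⟨l.get, List.ofFn_get l⟩

variable [Finite Y] [DiscreteMeasurableSpace Y]

theorem le_minimaxMistakes {H : Set (X → Y)} {T : ℕ} {c : ℝ}
    (hc : ∀ A : RandomizedLearner X Y S, ∃ l : List (X × S), l.length = T ∧
      (∃ h ∈ H, ∀ e ∈ l, h e.1 ∈ (e.2 : Set Y)) ∧ c ≤ A.cumErr [] l) :
    (c : EReal) ≤ minimaxMistakes S H T := by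
  refine le_iInf fun A => ?_
  obtain ⟨l, hl, ⟨h, hh, hr⟩, hA⟩ := hc A
  obtain ⟨s, rfl⟩ := exists_ofFn_eq hl
  refine le_iSup₂_of_le s ⟨h, hh, fun t => hr _ (List.mem_ofFn.2 ⟨t, rfl⟩)⟩ ?_
  rw [A.integral_cumulativeLoss]
  exact_mod_cast hA

theorem minimaxMistakes_le {H : Set (X → Y)} {T : ℕ} {c : ℝ} (A : RandomizedLearner X Y S)
    (hc : ∀ l : List (X × S), l.length = T →
      ∀ h ∈ H, (∀ e ∈ l, h e.1 ∈ (e.2 : Set Y)) → A.cumErr [] l ≤ c) :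
    minimaxMistakes S H T ≤ (c : EReal) := by
  refine iInf_le_of_le A (iSup₂_le fun s hs => ?_)
  obtain ⟨h, hh, hr⟩ := hs
  rw [A.integral_cumulativeLoss]
  refine EReal.coe_le_coe_iff.2 (hc _ List.length_ofFn h hh fun e he => ?_)
  obtain ⟨t, rfl⟩ := List.mem_ofFn.1 he
  exact hr t

theorem le_minimaxRegret {H : Set (X → Y)} {T : ℕ} {c : ℝ}
    (hc : ∀ A : RandomizedLearner X Y S, ∃ l : List (X × S), l.length = T ∧
      ∃ h ∈ H, c ≤ A.cumErr [] l - hypLoss h l) :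
    (c : EReal) ≤ minimaxRegret S H T := by
  refine le_iInf fun A => ?_
  obtain ⟨l, hl, h, hh, hA⟩ := hc A
  obtain ⟨s, rfl⟩ := exists_ofFn_eq hl
  refine le_iSup_of_le s ?_
  rw [A.integral_cumulativeLoss_sub]
  exact EReal.coe_le_coe_iff.2 (by linarith [bestLoss_le hh s])

theorem minimaxRegret_le {H : Set (X → Y)} (hH : H.Nonempty) {T : ℕ} {c : ℝ}
    (A : RandomizedLearner X Y S)
    (hc : ∀ l : List (X × S), l.length = T → ∀ h ∈ H, A.cumErr [] l ≤ hypLoss h l + c) :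
    minimaxRegret S H T ≤ (c : EReal) := by
  refine iInf_le_of_le A (iSup_le fun s => ?_)
  rw [A.integral_cumulativeLoss_sub]
  refine EReal.coe_le_coe_iff.2 ?_
  have : A.cumErr [] (List.ofFn s) - c ≤ bestLoss H s :=
    le_bestLoss hH fun h hh => by linarith [hc (List.ofFn s) List.length_ofFn h hh]
  linarith

end Losses

/-! ### The simple random walk -/

section RandomWalk

/-- The expected distance to the origin after `k` steps of the simple random walk started
at `s`. -/
noncomputable def absWalk : ℕ → ℤ → ℝ
  | 0, s => |(s : ℝ)|
  | k + 1, s => (absWalk k (s + 1) + absWalk k (s - 1)) / 2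

/-- The probability that the simple random walk started at `s` is at the origin after `k` steps. -/
noncomputable def hitProb : ℕ → ℤ → ℝ
  | 0, s => if s = 0 then 1 else 0
  | k + 1, s => (hitProb k (s + 1) + hitProb k (s - 1)) / 2

theorem hitProb_nonneg (k : ℕ) (s : ℤ) : 0 ≤ hitProb k s := by
  induction k generalizing s with
  | zero => unfold hitProb; split_ifs <;> norm_num
  | succ k ih => unfold hitProb; linarith [ih (s + 1), ih (s - 1)]

/-- Discrete Tanaka formula: the absolute value is harmonic off the origin, and at the origin one
step raises its mean by 1. -/
theorem absWalk_succ_eq (k : ℕ) (s : ℤ) : absWalk (k + 1) s = absWalk k s + hitProb k s := by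
  induction k generalizing s with
  | zero =>
    simp only [absWalk, hitProb]
    push_cast
    rcases lt_trichotomy s 0 with h | rfl | h
    · have : (s : ℝ) + 1 ≤ 0 := by exact_mod_cast h
      rw [if_neg h.ne, abs_of_nonpos this, abs_of_nonpos (by linarith), abs_of_nonpos (by linarith)]
      ring
    · norm_num
    · have : 1 ≤ (s : ℝ) := by exact_mod_cast h
      rw [if_neg h.ne', abs_of_nonneg (by linarith : (0 : ℝ) ≤ s + 1),
        abs_of_nonneg (by linarith : (0 : ℝ) ≤ s - 1), abs_of_nonneg (by linarith : (0 : ℝ) ≤ s)]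
      ring
  | succ k ih =>
    rw [absWalk, ih, ih, absWalk, hitProb]
    ring

theorem hitProb_eq_zero_of_lt (k : ℕ) (s : ℤ) (h : (k : ℤ) < s) : hitProb k s = 0 := by
  induction k generalizing s with
  | zero => exact if_neg (by simpa using h.ne')
  | succ k ih =>
    push_cast at h
    rw [hitProb, ih _ (by omega), ih _ (by omega)]
    simp

/-- Pascal's rule: reaching the origin from `k - 2 * i` in `k` steps takes exactly `i` upward steps.
-/
theorem hitProb_eq_choose (k i : ℕ) : hitProb k ((k : ℤ) - 2 * i) = k.choose i / 2 ^ k := by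
  induction k generalizing i with
  | zero => rcases i with _ | i <;> simp [hitProb]; omega
  | succ k ih =>
    have h₁ : ((k + 1 : ℕ) : ℤ) - 2 * i - 1 = k - 2 * i := by push_cast; ring
    rw [hitProb, h₁, ih]
    rcases i with _ | i
    · rw [hitProb_eq_zero_of_lt _ _ (by push_cast; omega)]
      simp [pow_succ]
      ring
    · have h₂ : ((k + 1 : ℕ) : ℤ) - 2 * ((i + 1 : ℕ) : ℤ) + 1 = k - 2 * i := by push_cast; ring
      rw [h₂, ih, Nat.choose_succ_succ]
      push_cast
      rw [pow_succ]
      ring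

theorem hitProb_even (m : ℕ) : hitProb (2 * m) 0 = m.centralBinom / 4 ^ m := by
  have := hitProb_eq_choose (2 * m) m
  rw [pow_mul] at this
  norm_num at this
  exact this

theorem hitProb_even_succ (m : ℕ) :
    2 * (m + 1) * hitProb (2 * (m + 1)) 0 = (2 * m + 1) * hitProb (2 * m) 0 := by
  have h : ((m : ℝ) + 1) * (m + 1).centralBinom = 2 * (2 * m + 1) * m.centralBinom := by
    exact_mod_cast Nat.succ_mul_centralBinom_succ m
  rw [hitProb_even, hitProb_even, pow_succ]
  field_simp
  linarith

/-- Sum the increments from `absWalk_succ_eq`; the ratio of consecutive return probabilities makes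
the sum telescope. The return term at an odd time is simply dropped. -/
theorem le_absWalk_even (m : ℕ) : 2 * m * hitProb (2 * m) 0 ≤ absWalk (2 * m) 0 := by
  induction m with
  | zero => simp [absWalk]
  | succ m ih =>
    have h : absWalk (2 * (m + 1)) 0 =
        absWalk (2 * m) 0 + hitProb (2 * m) 0 + hitProb (2 * m + 1) 0 := by
      rw [← absWalk_succ_eq, ← absWalk_succ_eq]; rfl
    rw [h]
    push_cast
    rw [hitProb_even_succ]
    linarith [hitProb_nonneg (2 * m + 1) 0]

/-- Wallis-type bound: with `n = m + 1`, the right-hand side equals 1 at `n = 1` and is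
nondecreasing because `(2n + 1)² ≥ 4n(n + 1)`. -/
theorem one_le_four_mul_hitProb_sq (m : ℕ) :
    1 ≤ 4 * (m + 1) * hitProb (2 * (m + 1)) 0 ^ 2 := by
  induction m with
  | zero =>
    have := hitProb_even_succ 0
    norm_num [hitProb] at this ⊢
  | succ m ih =>
    have h := hitProb_even_succ (m + 1)
    set a := hitProb (2 * (m + 1)) 0
    set b := hitProb (2 * (m + 1 + 1)) 0
    push_cast at h ⊢
    have hm : (0 : ℝ) ≤ m := m.cast_nonneg
    have h2 : 4 * ((m : ℝ) + 1 + 1) ^ 2 * b ^ 2 = (2 * (m + 1) + 1) ^ 2 * a ^ 2 := by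
      linear_combination (2 * (m + 1 + 1) * b + (2 * (m + 1) + 1) * a) * h
    have h3 : 4 * ((m : ℝ) + 1) * (m + 1 + 1) * a ^ 2 ≤ (2 * (m + 1) + 1) ^ 2 * a ^ 2 :=
      mul_le_mul_of_nonneg_right (by nlinarith) (sq_nonneg a)
    have h4 : ((m : ℝ) + 1 + 1) * 1 ≤ (m + 1 + 1) * (4 * (m + 1 + 1) * b ^ 2) := by
      nlinarith
    exact le_of_mul_le_mul_left h4 (by positivity)

/-- This is for `T = d * k + r` rounds cut into `r` blocks of length `k + 1` and `d - r` of length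
`k`. For even `k` the sum is at least `T * c`, with `c` the return probability at time `k`. For odd
`k` the `r` term is dropped and `T ≤ d * (k + 1)` is used instead. -/
theorem sqrt_le_add_absWalk (d k r : ℕ) (hk : 1 ≤ k) (hr : r ≤ d) :
    √((d : ℝ) * (d * k + r) / 2) ≤ r * absWalk (k + 1) 0 + (d - r) * absWalk k 0 := by
  have hr' : (r : ℝ) ≤ d := by exact_mod_cast hr
  have hd : (0 : ℝ) ≤ d := d.cast_nonneg
  have hr0 : (0 : ℝ) ≤ r := r.cast_nonneg
  have heq : r * absWalk (k + 1) 0 + (d - r) * absWalk k 0 =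
      d * absWalk k 0 + r * hitProb k 0 := by
    rw [absWalk_succ_eq]; ring
  rw [heq]
  obtain ⟨m, rfl | rfl⟩ : ∃ m, k = 2 * (m + 1) ∨ k = 2 * m + 1 := by
    rcases Nat.even_or_odd' k with ⟨m, rfl | rfl⟩
    · exact ⟨m - 1, Or.inl (by omega)⟩
    · exact ⟨m, Or.inr rfl⟩
  · have h₁ := le_absWalk_even (m + 1)
    have h₂ := one_le_four_mul_hitProb_sq m
    have h₃ := hitProb_nonneg (2 * (m + 1)) 0
    set c := hitProb (2 * (m + 1)) 0
    push_cast at h₁ ⊢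
    refine le_trans ?_ (add_le_add_left (mul_le_mul_of_nonneg_left h₁ hd) _)
    refine Real.sqrt_le_iff.2 ⟨by positivity, ?_⟩
    have hu : 0 ≤ (d : ℝ) * (2 * (m + 1)) + r := by positivity
    have : (d : ℝ) / 2 ≤ (d * (2 * (m + 1)) + r) * c ^ 2 := by
      nlinarith [mul_nonneg hr0 (sq_nonneg c), mul_le_mul_of_nonneg_left h₂ hd]
    nlinarith [mul_le_mul_of_nonneg_left this hu]
  · have h₁ : (2 * m + 1) * hitProb (2 * m) 0 ≤ absWalk (2 * m + 1) 0 := by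
      rw [absWalk_succ_eq]
      linarith [le_absWalk_even m]
    rw [← hitProb_even_succ] at h₁
    have h₂ := one_le_four_mul_hitProb_sq m
    have h₃ := hitProb_nonneg (2 * (m + 1)) 0
    have h₄ := mul_nonneg hr0 (hitProb_nonneg (2 * m + 1) 0)
    set c := hitProb (2 * (m + 1)) 0
    push_cast
    refine le_trans ?_ ((mul_le_mul_of_nonneg_left h₁ hd).trans (le_add_of_nonneg_right h₄))
    refine Real.sqrt_le_iff.2 ⟨by positivity, ?_⟩
    have hm : (0 : ℝ) ≤ m + 1 := by positivity
    calc (d : ℝ) * (d * (2 * m + 1) + r) / 2 ≤ d ^ 2 * ((m + 1) * 1) := by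
          nlinarith [mul_le_mul_of_nonneg_left hr' hd]
      _ ≤ d ^ 2 * ((m + 1) * (4 * (m + 1) * c ^ 2)) := by gcongr
      _ = _ := by ring

end RandomWalk

/-! ### Lower bounds -/

section LowerBounds

variable {X Y : Type*} {S : Set (Set Y)} [MeasurableSpace Y]

theorem PairShatters.exists_realizable (A : RandomizedLearner X Y S) {d : ℕ} {V : Set (X → Y)}
    (hV : PairShatters S d V) (hist : List (X × S)) :
    ∃ l : List (X × S), l.length = d ∧ ∃ h ∈ V, (∀ e ∈ l, h e.1 ∈ (e.2 : Set Y)) ∧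
      (d : ℝ) / 2 ≤ A.cumErr hist l := by
  induction d generalizing V hist with
  | zero =>
    obtain ⟨h, hh⟩ := hV
    exact ⟨[], rfl, h, hh, by simp, by simp [RandomizedLearner.cumErr]⟩
  | succ d ih =>
    obtain ⟨x, s₁, s₂, hs, h₁, h₂⟩ := hV
    obtain ⟨s, hsV, hs⟩ : ∃ s : S, PairShatters S d (restrict V (x, s)) ∧
        1 / 2 ≤ A.err hist (x, s) := by
      have := A.one_le_err_add_err hist x hs
      rcases le_total (A.err hist (x, s₁)) (A.err hist (x, s₂)) with h | h
      · exact ⟨s₂, h₂, by linarith⟩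
      · exact ⟨s₁, h₁, by linarith⟩
    obtain ⟨l, hl, h, hh, hr, hA⟩ := ih hsV (hist ++ [(x, s)])
    refine ⟨(x, s) :: l, by simp [hl], h, hh.1, ?_, ?_⟩
    · simpa using ⟨hh.2, by simpa using hr⟩
    · rw [RandomizedLearner.cumErr]
      push_cast
      linarith

/-- Derandomized coin flips: `absWalk (k + 1) a` averages its two successors and the two errors sum
to at least 1, so one set preserves the bound. The offset `a` records the current imbalance for the
induction. -/
theorem exists_block (A : RandomizedLearner X Y S) (x : X) {s₁ s₂ : S}
    (hs : (s₁ : Set Y) ∩ s₂ = ∅) (k : ℕ) (hist : List (X × S)) (a : ℤ) :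
    ∃ l : List (X × S), l.length = k ∧ ∃ n₁ n₂ : ℕ, n₁ + n₂ = k ∧
      (∀ h : X → Y, h x ∈ (s₁ : Set Y) → hypLoss h l ≤ n₂) ∧
      (∀ h : X → Y, h x ∈ (s₂ : Set Y) → hypLoss h l ≤ n₁) ∧
      absWalk k a / 2 + k / 2 ≤ A.cumErr hist l + |(a : ℝ) + n₁ - n₂| / 2 := by
  induction k generalizing hist a with
  | zero => exact ⟨[], rfl, 0, 0, rfl, by simp, by simp, by simp [absWalk, RandomizedLearner.cumErr]⟩
  | succ k ih =>
    have herr := A.one_le_err_add_err hist x hs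
    rcases le_total (A.err hist (x, s₂) + absWalk k (a - 1) / 2)
      (A.err hist (x, s₁) + absWalk k (a + 1) / 2) with hle | hle
    · obtain ⟨l, hl, n₁, n₂, hn, h₁, h₂, hA⟩ := ih (hist ++ [(x, s₁)]) (a + 1)
      refine ⟨(x, s₁) :: l, by simp [hl], n₁ + 1, n₂, by omega, fun h hh => ?_, fun h hh => ?_, ?_⟩
      · rw [hypLoss_cons, miss_of_mem hh]
        linarith [h₁ h hh]
      · rw [hypLoss_cons]
        push_cast
        linarith [h₂ h hh, miss_le_one (h x) s₁]
      · rw [RandomizedLearner.cumErr, absWalk]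
        push_cast at hA ⊢
        rw [show (a : ℝ) + (n₁ + 1) - n₂ = a + 1 + n₁ - n₂ by ring]
        linarith
    · obtain ⟨l, hl, n₁, n₂, hn, h₁, h₂, hA⟩ := ih (hist ++ [(x, s₂)]) (a - 1)
      refine ⟨(x, s₂) :: l, by simp [hl], n₁, n₂ + 1, by omega, fun h hh => ?_, fun h hh => ?_, ?_⟩
      · rw [hypLoss_cons]
        push_cast
        linarith [h₁ h hh, miss_le_one (h x) s₂]
      · rw [hypLoss_cons, miss_of_mem hh]
        linarith [h₂ h hh]
      · rw [RandomizedLearner.cumErr, absWalk]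
        push_cast at hA ⊢
        rw [show (a : ℝ) + n₁ - (n₂ + 1) = a - 1 + n₁ - n₂ by ring]
        linarith

theorem PairShatters.exists_regret (A : RandomizedLearner X Y S) (ks : List ℕ) {V : Set (X → Y)}
    (hV : PairShatters S ks.length V) (hist : List (X × S)) :
    ∃ l : List (X × S), l.length = ks.sum ∧ ∃ h ∈ V,
      (ks.map fun k => absWalk k 0).sum / 2 ≤ A.cumErr hist l - hypLoss h l := by
  induction ks generalizing V hist with
  | nil =>
    obtain ⟨h, hh⟩ := hV
    exact ⟨[], rfl, h, hh, by simp [RandomizedLearner.cumErr]⟩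
  | cons k ks ih =>
    obtain ⟨x, s₁, s₂, hs, hV₁, hV₂⟩ := hV
    obtain ⟨b, hb, n₁, n₂, hn, h₁, h₂, hA⟩ := exists_block A x hs k hist 0
    have hn' : (n₁ : ℝ) + n₂ = k := by exact_mod_cast hn
    -- Descend to the majority set: its hypotheses err at most `min n₁ n₂` times, and this cancels
    -- the absolute value in `hA`.
    obtain ⟨s, hsV, hsl⟩ : ∃ s : S, PairShatters S ks.length (restrict V (x, s)) ∧
        ∀ h : X → Y, h x ∈ (s : Set Y) → hypLoss h b ≤ (k - |(n₁ : ℝ) - n₂|) / 2 := by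
      rcases le_total (n₁ : ℝ) n₂ with h | h
      · refine ⟨s₂, hV₂, fun g hg => (h₂ g hg).trans ?_⟩
        rw [abs_of_nonpos (by linarith)]
        linarith
      · refine ⟨s₁, hV₁, fun g hg => (h₁ g hg).trans ?_⟩
        rw [abs_of_nonneg (by linarith)]
        linarith
    obtain ⟨l, hl, h, hh, hlA⟩ := ih hsV (hist ++ b)
    refine ⟨b ++ l, by simp [hb, hl], h, hh.1, ?_⟩
    have := hsl h hh.2
    rw [A.cumErr_append, hypLoss_append, List.map_cons, List.sum_cons]
    simp only [Int.cast_zero, zero_add] at hA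
    linarith

variable [Finite Y] [DiscreteMeasurableSpace Y]

theorem half_le_minimaxMistakes [Nonempty X] (hS : ∀ y : Y, ∃ s ∈ S, y ∈ s) {H : Set (X → Y)}
    {d T : ℕ} (hdT : d ≤ T) (hd : PairShatters S d H) :
    (((d : ℝ) / 2 : ℝ) : EReal) ≤ minimaxMistakes S H T := by
  refine le_minimaxMistakes fun A => ?_
  obtain ⟨l, hl, h, hh, hr, hA⟩ := hd.exists_realizable A []
  obtain ⟨s, hsS, hs⟩ := hS (h (Classical.arbitrary X))
  -- Pad to length `T` with examples that `h` satisfies; they keep the stream realizable and cannot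
  -- lower the learner's loss.
  refine ⟨l ++ List.replicate (T - d) (Classical.arbitrary X, ⟨s, hsS⟩), by simp; omega,
    ⟨h, hh, fun e he => ?_⟩, ?_⟩
  · rcases List.mem_append.1 he with he | he
    · exact hr e he
    · rw [List.eq_of_mem_replicate he]
      exact hs
  · rw [A.cumErr_append]
    linarith [A.cumErr_nonneg ([] ++ l)
      (List.replicate (T - d) (Classical.arbitrary X, ⟨s, hsS⟩))]

theorem sqrt_le_minimaxRegret [Nonempty X] (hS : ∀ y : Y, ∃ s ∈ S, y ∈ s) {H : Set (X → Y)}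
    {d T : ℕ} (hdT : d ≤ 2 * T) (hd : PairShatters S d H) :
    ((√((d : ℝ) * T / 8) : ℝ) : EReal) ≤ minimaxRegret S H T := by
  rcases Nat.eq_zero_or_pos d with rfl | hd0
  · obtain ⟨h, hh⟩ := hd
    obtain ⟨s, hsS, hs⟩ := hS (h (Classical.arbitrary X))
    refine le_minimaxRegret fun A => ⟨List.replicate T (Classical.arbitrary X, ⟨s, hsS⟩),
      by simp, h, hh, ?_⟩
    have : hypLoss h (List.replicate T (Classical.arbitrary X, (⟨s, hsS⟩ : S))) = 0 := by
      simp [hypLoss, miss_of_mem hs]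
    rw [this]
    simpa using A.cumErr_nonneg _ _
  have hsqrt (u : ℝ) : √(u / 8) = √(u / 2) / 2 := by
    rw [show u / 8 = u / 2 / 2 ^ 2 by ring, Real.sqrt_div' _ (by norm_num),
      Real.sqrt_sq (by norm_num)]
  obtain ⟨ks, hlen, hsum, hks⟩ : ∃ ks : List ℕ, ks.length ≤ d ∧ ks.sum = T ∧
      √((d : ℝ) * T / 2) ≤ (ks.map fun k => absWalk k 0).sum := by
    rcases le_total T d with hTd | hTd
    -- With at least as many levels as rounds, use blocks of length one: the sum is `T`, and `d ≤ 2
    -- * T` gives `d * T / 2 ≤ T ^ 2`.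
    · refine ⟨List.replicate T 1, by simpa, by simp, ?_⟩
      have : (d : ℝ) ≤ 2 * T := by exact_mod_cast hdT
      simp only [List.map_replicate, List.sum_replicate, nsmul_eq_mul]
      rw [show absWalk 1 0 = 1 by norm_num [absWalk], mul_one]
      refine Real.sqrt_le_iff.2 ⟨by positivity, ?_⟩
      nlinarith [mul_le_mul_of_nonneg_right this (T.cast_nonneg : (0 : ℝ) ≤ T)]
    · have hr := Nat.mod_lt T hd0
      have hT := Nat.div_add_mod T d
      refine ⟨List.replicate (T % d) (T / d + 1) ++ List.replicate (d - T % d) (T / d), ?_, ?_, ?_⟩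
      · simp; omega
      · simp only [List.sum_append, List.sum_replicate, smul_eq_mul]
        have h : d = (T % d) + (d - T % d) := by omega
        calc _ = ((T % d) + (d - T % d)) * (T / d) + T % d := by ring
          _ = T := by rw [← h, hT]
      · have := sqrt_le_add_absWalk d (T / d) (T % d) (Nat.div_pos hTd hd0) hr.le
        simp only [List.map_append, List.map_replicate, List.sum_append, List.sum_replicate,
          nsmul_eq_mul, Nat.cast_sub hr.le]
        refine le_trans (le_of_eq ?_) this
        congr 3
        exact_mod_cast hT.symm
  refine le_minimaxRegret fun A => ?_
  obtain ⟨l, hl, h, hh, hA⟩ := (hd.of_le hlen).exists_regret A ks []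
  refine ⟨l, hl.trans hsum, h, hh, ?_⟩
  rw [hsqrt]
  linarith

end LowerBounds

/-! ### The standard optimal algorithm and its lazy version -/

section OptimalAlgorithm

variable {X Y : Type*} {S : Set (Set Y)}

open Classical in
/-- The version space after the examples of a list, numbered from `n`, when the update is made only
in the rounds that satisfy `P`. -/
noncomputable def lazyUpdate (P : ℕ → Prop) (V : Set (X → Y)) (n : ℕ) :
    List (X × S) → Set (X → Y)
  | [] => V
  | e :: l => lazyUpdate P (if P n then restrict V e else V) (n + 1) l

open Classical in
theorem lazyUpdate_append_singleton (P : ℕ → Prop) (V : Set (X → Y)) (n : ℕ) (l : List (X × S))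
    (e : X × S) : lazyUpdate P V n (l ++ [e]) =
      if P (n + l.length) then restrict (lazyUpdate P V n l) e else lazyUpdate P V n l := by
  induction l generalizing V n with
  | nil => rfl
  | cons e l ih =>
    rw [List.cons_append, lazyUpdate, ih, lazyUpdate, List.length_cons,
      show n + 1 + l.length = n + (l.length + 1) by omega]

variable [Nonempty Y]

/-- A label that is optimal for the version space `V` and the instance `x`: each set of `S` that
avoids it decreases the dimension of `V`. -/
noncomputable def optimalLabel (S : Set (Set Y)) (V : Set (X → Y)) (x : X) : Y :=
  Classical.epsilon fun y => ∀ d, ¬ SetShatters S (d + 1) V →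
    ∀ s : S, y ∉ (s : Set Y) → ¬ SetShatters S d (restrict V (x, s))

/-- At the least such `d`, if every label had an avoiding set preserving the dimension, `x` would
root a shattered tree of depth `d + 1`. By truncation, the label found there serves all larger `d`.
-/
theorem not_setShatters_restrict {V : Set (X → Y)} {x : X} {d : ℕ}
    (hd : ¬ SetShatters S (d + 1) V) {s : S} (hs : optimalLabel S V x ∉ (s : Set Y)) :
    ¬ SetShatters S d (restrict V (x, s)) := by
  classical
  refine Classical.epsilon_spec (p := fun y => ∀ d, ¬ SetShatters S (d + 1) V →
    ∀ s : S, y ∉ (s : Set Y) → ¬ SetShatters S d (restrict V (x, s))) ?_ d hd s hs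
  have hex : ∃ d, ¬ SetShatters S (d + 1) V := ⟨d, hd⟩
  have hmin := Nat.find_spec hex
  have hy : ∃ y : Y, ∀ s : S, y ∉ (s : Set Y) →
      ¬ SetShatters S (Nat.find hex) (restrict V (x, s)) := by
    by_contra! hcon
    exact hmin ⟨x, hcon⟩
  obtain ⟨y, hy⟩ := hy
  exact ⟨y, fun n hn s hs h => hy s hs (h.of_le (Nat.find_min' hex hn))⟩

open Classical in
/-- The number of mistakes of the optimal labels on a list of examples, numbered from `n`, when the
version space `V` is updated only in the rounds that satisfy `P`. -/
noncomputable def lazyLoss (P : ℕ → Prop) (V : Set (X → Y)) (n : ℕ) : List (X × S) → ℝ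
  | [] => 0
  | e :: l => miss (optimalLabel S V e.1) e.2 +
      lazyLoss P (if P n then restrict V e else V) (n + 1) l

open Classical in
-- The update made in the last round affects no prediction, hence the strict bound on `i + 1`.
theorem lazyLoss_congr {P Q : ℕ → Prop} (V : Set (X → Y)) (n : ℕ) (l : List (X × S))
    (hPQ : ∀ i, n ≤ i → i + 1 < n + l.length → (P i ↔ Q i)) :
    lazyLoss P V n l = lazyLoss Q V n l := by
  induction l generalizing V n with
  | nil => rfl
  | cons e l ih =>
    rw [List.length_cons] at hPQ
    rcases l with _ | ⟨e', l⟩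
    · rfl
    · rw [lazyLoss, ih _ _ fun i hi hil => hPQ i (by omega) (by omega),
        if_congr (hPQ n le_rfl (by simp)) rfl rfl]
      rfl

theorem lazyLoss_true_le {d : ℕ} {V : Set (X → Y)} (hd : ¬ SetShatters S (d + 1) V) (n : ℕ)
    (l : List (X × S)) {h : X → Y} (hV : h ∈ V) (hl : ∀ e ∈ l, h e.1 ∈ (e.2 : Set Y)) :
    lazyLoss (fun _ => True) V n l ≤ d := by
  induction l generalizing V n d with
  | nil => simp [lazyLoss]
  | cons e l ih =>
    simp only [List.forall_mem_cons] at hl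
    have hh : h ∈ restrict V e := ⟨hV, hl.1⟩
    rw [lazyLoss, if_pos trivial]
    by_cases he : optimalLabel S V e.1 ∈ (e.2 : Set Y)
    · rw [miss_of_mem he, zero_add]
      exact ih (fun hs => hd (hs.mono (restrict_subset _ _))) _ hh hl.2
    · have hs := not_setShatters_restrict hd he
      rcases d with _ | d
      -- At dimension zero a mistake would empty the version space, but `h` survives.
      · exact absurd ⟨h, hh⟩ hs
      · rw [miss_of_notMem he]
        push_cast
        linarith [ih hs (n + 1) hh hl.2]

/-- Update exactly where the optimal label errs and `h` does not. Each update lowers the dimension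
and keeps `h`; in every other round a mistake is also one of `h`. -/
theorem exists_lazyLoss_le {d : ℕ} {V : Set (X → Y)} (hd : ¬ SetShatters S (d + 1) V) (n : ℕ)
    (l : List (X × S)) {h : X → Y} (hV : h ∈ V) :
    ∃ M : Finset ℕ, M.card ≤ d ∧ (∀ i ∈ M, n ≤ i ∧ i < n + l.length) ∧
      lazyLoss (· ∈ M) V n l ≤ hypLoss h l + M.card := by
  induction l generalizing V n d with
  | nil => exact ⟨∅, by simp, by simp, by simp [lazyLoss]⟩
  | cons e l ih =>
    by_cases hup : optimalLabel S V e.1 ∉ (e.2 : Set Y) ∧ h e.1 ∈ (e.2 : Set Y)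
    · have hs := not_setShatters_restrict hd hup.1
      have hh : h ∈ restrict V e := ⟨hV, hup.2⟩
      rcases d with _ | d
      · exact absurd ⟨h, hh⟩ hs
      obtain ⟨M, hM, hMn, hle⟩ := ih hs (n + 1) hh
      have hn : n ∉ M := fun hn => by have := (hMn n hn).1; omega
      refine ⟨insert n M, by rw [Finset.card_insert_of_notMem hn]; omega, fun i hi => ?_, ?_⟩
      · rw [List.length_cons]
        rcases Finset.mem_insert.1 hi with rfl | hi
        · omega
        · have := hMn i hi; omega
      · rw [lazyLoss, if_pos (Finset.mem_insert_self n M), hypLoss_cons, miss_of_notMem hup.1,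
          miss_of_mem hup.2, Finset.card_insert_of_notMem hn,
          lazyLoss_congr (Q := (· ∈ M)) _ _ _ fun i hi _ => by
            simp [show i ≠ n by omega]]
        push_cast
        linarith
    · obtain ⟨M, hM, hMn, hle⟩ := ih hd (n + 1) hV
      have hn : n ∉ M := fun hn => by have := (hMn n hn).1; omega
      refine ⟨M, hM, fun i hi => ?_, ?_⟩
      · rw [List.length_cons]
        have := hMn i hi; omega
      · rw [lazyLoss, if_neg hn, hypLoss_cons]
        have : miss (optimalLabel S V e.1) (e.2 : Set Y) ≤ miss (h e.1) e.2 := by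
          by_cases ho : optimalLabel S V e.1 ∈ (e.2 : Set Y)
          · rw [miss_of_mem ho]; exact miss_nonneg _ _
          · rw [miss_of_notMem (s := (e.2 : Set Y)) fun hh => hup ⟨ho, hh⟩]
            exact miss_le_one _ _
        linarith

/-- The rounds listed by `g` are enough for the lazy updates of at least one `g : Fin d → Fin T`. -/
theorem exists_fun_lazyLoss_le {d : ℕ} {V : Set (X → Y)} (hd : ¬ SetShatters S (d + 1) V)
    {l : List (X × S)} (hl : l ≠ []) {h : X → Y} (hV : h ∈ V) :
    ∃ g : Fin d → Fin l.length,
      lazyLoss (fun i => ∃ j, (g j : ℕ) = i) V 0 l ≤ hypLoss h l + d := by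
  obtain ⟨M, hM, hMn, hle⟩ := exists_lazyLoss_le hd 0 l hV
  have hMd : (M.card : ℝ) ≤ d := by exact_mod_cast hM
  have hpos := List.length_pos_iff.2 hl
  rcases M.eq_empty_or_nonempty with rfl | hne
  -- The functions must take some value; the last round is a harmless default by `lazyLoss_congr`.
  · refine ⟨fun _ => ⟨l.length - 1, by omega⟩, ?_⟩
    rw [lazyLoss_congr (Q := (· ∈ (∅ : Finset ℕ))) _ _ _ fun i _ hi => ?_]
    · linarith
    · simp only [Finset.notMem_empty, iff_false, not_exists]
      intro _; omega
  · have : Nonempty M := hne.to_subtype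
    obtain ⟨f, hf⟩ : ∃ f : Fin d → M, Function.Surjective f := by
      have hc : Fintype.card M ≤ Fintype.card (Fin d) := by simpa using hM
      obtain ⟨e⟩ := Function.Embedding.nonempty_of_card_le hc
      exact ⟨Function.invFun e, Function.invFun_surjective e.injective⟩
    refine ⟨fun j => ⟨f j, by have := (hMn _ (f j).2).2; omega⟩, ?_⟩
    rw [lazyLoss_congr (Q := (· ∈ M)) _ _ _ fun i _ _ => ?_]
    · linarith
    · refine ⟨?_, fun hi => ?_⟩
      · rintro ⟨j, rfl⟩
        exact (f j).2
      · obtain ⟨j, hj⟩ := hf ⟨i, hi⟩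
        exact ⟨j, by simp [hj]⟩

end OptimalAlgorithm

/-! ### Prediction with expert advice -/

section Experts

variable {X Y : Type*} {S : Set (Set Y)}

/-- The number of mistakes of the deterministic strategy `E` on a list of examples that follows the
list `hist`. -/
noncomputable def expertLoss (E : List (X × S) → X → Y) : List (X × S) → List (X × S) → ℝ
  | _, [] => 0
  | hist, e :: l => miss (E hist e.1) e.2 + expertLoss E (hist ++ [e]) l

theorem expertLoss_append_singleton (E : List (X × S) → X → Y) (hist l : List (X × S))
    (e : X × S) :
    expertLoss E hist (l ++ [e]) = expertLoss E hist l + miss (E (hist ++ l) e.1) e.2 := by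
  induction l generalizing hist with
  | nil => simp [expertLoss]
  | cons e l ih => simp [expertLoss, ih, add_assoc]

theorem expertLoss_optimalLabel [Nonempty Y] (P : ℕ → Prop) (V : Set (X → Y))
    (hist l : List (X × S)) :
    expertLoss (fun hist => optimalLabel S (lazyUpdate P V 0 hist)) hist l =
      lazyLoss P (lazyUpdate P V 0 hist) hist.length l := by
  induction l generalizing hist with
  | nil => rfl
  | cons e l ih =>
    rw [expertLoss, ih, lazyLoss, lazyUpdate_append_singleton, List.length_append, zero_add]
    rfl

variable {ι : Type*} [Fintype ι]

/-- The total weight of the experts `E` after the examples of the list `hist`. -/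
noncomputable def totalWeight (E : ι → List (X × S) → X → Y) (η : ℝ) (hist : List (X × S)) : ℝ :=
  ∑ i, Real.exp (-η * expertLoss (E i) [] hist)

theorem totalWeight_pos [Nonempty ι] (E : ι → List (X × S) → X → Y) (η : ℝ) (hist : List (X × S)) :
    0 < totalWeight E η hist :=
  Finset.sum_pos (fun _ _ => Real.exp_pos _) Finset.univ_nonempty

/-- Compare with `1 / (1 + η + η² / 2)`, using `(1 + η + η² / 2)(1 - η + η² / 2) = 1 + η⁴ / 4`. -/
theorem exp_neg_le_quadratic {η : ℝ} (hη : 0 ≤ η) : Real.exp (-η) ≤ 1 - η + η ^ 2 / 2 := by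
  have h := Real.quadratic_le_exp_of_nonneg hη
  rw [Real.exp_neg]
  refine inv_le_of_inv_le₀ (by nlinarith [sq_nonneg (η - 1)]) ?_
  refine le_trans ?_ h
  rw [inv_le_iff_one_le_mul₀ (by nlinarith [sq_nonneg (η - 1)])]
  nlinarith [sq_nonneg (η ^ 2)]

variable [MeasurableSpace Y]

/-- The learner that follows the deterministic strategy `E`. -/
noncomputable def deterministicLearner (E : List (X × S) → X → Y) : RandomizedLearner X Y S :=
  fun hist x => ⟨Measure.dirac (E hist x), inferInstance⟩

theorem cumErr_deterministicLearner [DiscreteMeasurableSpace Y] (E : List (X × S) → X → Y)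
    (hist l : List (X × S)) : (deterministicLearner E).cumErr hist l = expertLoss E hist l := by
  induction l generalizing hist with
  | nil => rfl
  | cons e l ih =>
    rw [RandomizedLearner.cumErr, expertLoss, ih]
    congr 1
    by_cases h : E hist e.1 ∈ (e.2 : Set Y) <;>
      simp [RandomizedLearner.err, deterministicLearner, miss, measureReal_def, h]

/-- The distribution on the labels `y i` with probabilities `p i`. -/
noncomputable def mixture (p : ι → ℝ) (hp : ∀ i, 0 ≤ p i) (hsum : ∑ i, p i = 1) (y : ι → Y) :
    ProbabilityMeasure Y :=
  ⟨∑ i, ENNReal.ofReal (p i) • Measure.dirac (y i), ⟨by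
    simp [← ENNReal.ofReal_sum_of_nonneg fun i _ => hp i, hsum]⟩⟩

theorem mixture_real_compl [DiscreteMeasurableSpace Y] (p : ι → ℝ) (hp : ∀ i, 0 ≤ p i)
    (hsum : ∑ i, p i = 1) (y : ι → Y) (s : Set Y) :
    (mixture p hp hsum y : Measure Y).real sᶜ = ∑ i, p i * miss (y i) s := by
  have : (mixture p hp hsum y : Measure Y) sᶜ = ENNReal.ofReal (∑ i, p i * miss (y i) s) := by
    rw [ENNReal.ofReal_sum_of_nonneg fun i _ => mul_nonneg (hp i) (miss_nonneg _ _)]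
    simp only [mixture, ProbabilityMeasure.coe_mk, Measure.coe_finsetSum, Finset.sum_apply,
      Measure.smul_apply, smul_eq_mul]
    refine Finset.sum_congr rfl fun i _ => ?_
    by_cases h : y i ∈ s <;> simp [miss, h]
  rw [measureReal_def, this, ENNReal.toReal_ofReal]
  exact Finset.sum_nonneg fun i _ => mul_nonneg (hp i) (miss_nonneg _ _)

variable [Nonempty ι]

/-- The exponentially weighted forecaster with experts `E` and learning rate `η`. -/
noncomputable def hedge (E : ι → List (X × S) → X → Y) (η : ℝ) : RandomizedLearner X Y S :=
  fun hist x => mixture (fun i => Real.exp (-η * expertLoss (E i) [] hist) / totalWeight E η hist)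
    (fun _ => div_nonneg (Real.exp_pos _).le (totalWeight_pos E η hist).le)
    (by rw [← Finset.sum_div]; exact div_self (totalWeight_pos E η hist).ne')
    fun i => E i hist x

variable [DiscreteMeasurableSpace Y]

/-- The error probability of `hedge` is the weighted average of the expert losses, so the quadratic
bound on each factor averages to it; `1 + x ≤ exp x` then restores an exponential. -/
theorem totalWeight_append_le (E : ι → List (X × S) → X → Y) {η : ℝ} (hη : 0 ≤ η)
    (hist : List (X × S)) (e : X × S) :
    totalWeight E η (hist ++ [e]) ≤
      totalWeight E η hist * Real.exp (-η * (hedge E η).err hist e + η ^ 2 / 2) := by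
  have hW := totalWeight_pos E η hist
  have herr : totalWeight E η hist * (hedge E η).err hist e =
      ∑ i, Real.exp (-η * expertLoss (E i) [] hist) * miss (E i hist e.1) e.2 := by
    rw [RandomizedLearner.err, hedge, mixture_real_compl, Finset.mul_sum]
    refine Finset.sum_congr rfl fun i _ => ?_
    field_simp
  have hexp (y : Y) (s : Set Y) : Real.exp (-η * miss y s) ≤ 1 - η * miss y s + η ^ 2 / 2 := by
    by_cases hy : y ∈ s
    · rw [miss_of_mem hy]
      simp only [mul_zero, Real.exp_zero, sub_zero]
      nlinarith [sq_nonneg η]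
    · rw [miss_of_notMem hy]
      simpa using exp_neg_le_quadratic hη
  calc totalWeight E η (hist ++ [e])
      = ∑ i, Real.exp (-η * expertLoss (E i) [] hist) *
          Real.exp (-η * miss (E i hist e.1) e.2) := by
        refine Finset.sum_congr rfl fun i _ => ?_
        rw [expertLoss_append_singleton, mul_add, Real.exp_add]
        rfl
    _ ≤ ∑ i, Real.exp (-η * expertLoss (E i) [] hist) *
          (1 - η * miss (E i hist e.1) e.2 + η ^ 2 / 2) :=
        Finset.sum_le_sum fun i _ => mul_le_mul_of_nonneg_left (hexp _ _) (Real.exp_pos _).le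
    _ = totalWeight E η hist * (-η * (hedge E η).err hist e + η ^ 2 / 2 + 1) := by
        have : totalWeight E η hist * (-η * (hedge E η).err hist e + η ^ 2 / 2 + 1) =
          totalWeight E η hist * (1 + η ^ 2 / 2) -
            η * (totalWeight E η hist * (hedge E η).err hist e) := by ring
        rw [this, herr, totalWeight, Finset.sum_mul, Finset.mul_sum, ← Finset.sum_sub_distrib]
        exact Finset.sum_congr rfl fun i _ => by ring
    _ ≤ _ := mul_le_mul_of_nonneg_left (Real.add_one_le_exp _) hW.le

theorem mul_cumErr_hedge_le (E : ι → List (X × S) → X → Y) {η : ℝ} (hη : 0 ≤ η)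
    (hist l : List (X × S)) :
    η * (hedge E η).cumErr hist l ≤ Real.log (totalWeight E η hist) -
      Real.log (totalWeight E η (hist ++ l)) + l.length * (η ^ 2 / 2) := by
  induction l generalizing hist with
  | nil => simp [RandomizedLearner.cumErr]
  | cons e l ih =>
    have h := Real.log_le_log (totalWeight_pos E η _) (totalWeight_append_le E hη hist e)
    rw [Real.log_mul (totalWeight_pos E η hist).ne' (Real.exp_pos _).ne', Real.log_exp] at h
    have := ih (hist ++ [e])
    rw [List.append_assoc, List.singleton_append] at this
    rw [RandomizedLearner.cumErr, List.length_cons]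
    push_cast
    linarith

/-- The logarithm of the total weight telescopes from the log of the number of experts, and stays
above the log-weight of expert `i`. -/
theorem cumErr_hedge_le (E : ι → List (X × S) → X → Y) {η : ℝ} (hη : 0 < η) (l : List (X × S))
    (i : ι) :
    (hedge E η).cumErr [] l ≤
      expertLoss (E i) [] l + (Real.log (Fintype.card ι) / η + l.length * η / 2) := by
  have h := mul_cumErr_hedge_le E hη.le [] l
  have h₀ : totalWeight E η [] = Fintype.card ι := by simp [totalWeight, expertLoss]
  have h₁ : -η * expertLoss (E i) [] l ≤ Real.log (totalWeight E η ([] ++ l)) := by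
    rw [Real.le_log_iff_exp_le (totalWeight_pos E η _)]
    exact Finset.single_le_sum (f := fun i => Real.exp (-η * expertLoss (E i) [] l))
      (fun _ _ => (Real.exp_pos _).le) (Finset.mem_univ i)
  rw [h₀] at h
  refine le_of_mul_le_mul_left ?_ hη
  have : η * (expertLoss (E i) [] l + (Real.log (Fintype.card ι) / η + l.length * η / 2)) =
      η * expertLoss (E i) [] l + Real.log (Fintype.card ι) + l.length * (η ^ 2 / 2) := by
    field_simp
    ring
  linarith

end Experts

/-! ### Upper bounds -/

section UpperBounds

variable {X Y : Type*} {S : Set (Set Y)} [Nonempty Y] [MeasurableSpace Y] [Finite Y]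
  [DiscreteMeasurableSpace Y]

theorem minimaxMistakes_le_of_not_setShatters {H : Set (X → Y)} {d : ℕ}
    (hd : ¬ SetShatters S (d + 1) H) (T : ℕ) : minimaxMistakes S H T ≤ ((d : ℝ) : EReal) := by
  refine minimaxMistakes_le (deterministicLearner fun hist =>
    optimalLabel S (lazyUpdate (fun _ => True) H 0 hist)) fun l _ h hh hr => ?_
  rw [cumErr_deterministicLearner, expertLoss_optimalLabel]
  exact lazyLoss_true_le hd _ l hh hr

theorem minimaxRegret_le_of_rate {H : Set (X → Y)} (hH : H.Nonempty) {d : ℕ}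
    (hd : ¬ SetShatters S (d + 1) H) {T : ℕ} (hT : 0 < T) {η : ℝ} (hη : 0 < η) :
    minimaxRegret S H T ≤ ((d + (d * Real.log T / η + T * η / 2) : ℝ) : EReal) := by
  have : Nonempty (Fin T) := ⟨⟨0, hT⟩⟩
  refine minimaxRegret_le hH (hedge (fun (g : Fin d → Fin T) hist =>
    optimalLabel S (lazyUpdate (fun i => ∃ j, (g j : ℕ) = i) H 0 hist)) η) ?_
  rintro l rfl h hh
  obtain ⟨g, hg⟩ := exists_fun_lazyLoss_le hd (List.length_pos_iff.1 hT) hh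
  refine (cumErr_hedge_le _ hη l g).trans ?_
  rw [expertLoss_optimalLabel, Fintype.card_fun, Fintype.card_fin, Fintype.card_fin, Nat.cast_pow,
    Real.log_pow]
  exact (add_le_add_left hg _).trans_eq (add_assoc _ _ _)

theorem minimaxRegret_le_horizon {H : Set (X → Y)} (hH : H.Nonempty) (T : ℕ) :
    minimaxRegret S H T ≤ ((T : ℝ) : EReal) := by
  refine minimaxRegret_le hH (deterministicLearner fun _ _ => Classical.arbitrary Y) ?_
  rintro l rfl h -
  refine (RandomizedLearner.cumErr_le_length _ _ l).trans ?_
  linarith [hypLoss_nonneg h l]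

theorem minimaxRegret_le_of_not_setShatters {H : Set (X → Y)} (hH : H.Nonempty) {d : ℕ}
    (hd : ¬ SetShatters S (d + 1) H) (T : ℕ) :
    minimaxRegret S H T ≤ ((d + √(2 * d * T * Real.log T) : ℝ) : EReal) := by
  -- Short horizons need only the trivial bound; afterwards `d ≥ 1` forces `T ≥ 2`, so that
  -- `Real.log T` is positive.
  rcases le_or_gt T d with hTd | hTd
  · refine (minimaxRegret_le_horizon hH T).trans (EReal.coe_le_coe_iff.2 ?_)
    have : (T : ℝ) ≤ d := by exact_mod_cast hTd
    linarith [Real.sqrt_nonneg (2 * d * T * Real.log T)]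
  have hT : 0 < T := by omega
  have hT' : (0 : ℝ) < T := by exact_mod_cast hT
  rcases Nat.eq_zero_or_pos d with rfl | hd0
  -- For `d = 0` the optimal rate would be zero, so the bound is a limit over rates `2 * c / T`,
  -- each giving exactly `c`.
  · refine EReal.le_of_forall_lt_iff_le.1 fun c hc => ?_
    have hc' : 0 < c := by simpa using hc
    refine (minimaxRegret_le_of_rate hH hd hT (η := 2 * c / T) (by positivity)).trans
      (EReal.coe_le_coe_iff.2 (le_of_eq ?_))
    simp only [Nat.cast_zero, zero_mul, zero_div, zero_add]
    field_simp
  · have hlog : 0 < Real.log T := Real.log_pos (by exact_mod_cast (by omega : 1 < T))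
    have hd' : (0 : ℝ) < d := by exact_mod_cast hd0
    set u := √(2 * d * T * Real.log T)
    have hu : 0 < u := Real.sqrt_pos.2 (by positivity)
    have hu2 : u ^ 2 = 2 * d * T * Real.log T := Real.sq_sqrt (by positivity)
    -- This rate balances the two terms: each equals `u / 2`.
    refine (minimaxRegret_le_of_rate hH hd hT (η := u / T) (by positivity)).trans
      (EReal.coe_le_coe_iff.2 (le_of_eq ?_))
    field_simp
    linarith

end UpperBounds

theorem mem_hammingBall_self {K : ℕ} (y : Fin K → Bool) (q : ℕ) : y ∈ hammingBall y q := by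
  simp [hammingBall]

theorem mainTheorem12 {X : Type*} [Nonempty X] (q K : ℕ) (hK : 2 * q + 1 ≤ K)
    (H : Set (X → (Fin K → Bool))) (hH : H.Nonempty) (T : ℕ) :
    -- realizable setting
    ((((min (pSetLittlestoneDim 2 (hammingBalls K q) H) T : ℕ∞) : ℝ≥0∞) / 2 : ℝ≥0∞) : EReal) ≤
        minimaxMistakes (hammingBalls K q) H T ∧
    minimaxMistakes (hammingBalls K q) H T ≤
        (((setLittlestoneDim (hammingBalls K q) H : ℕ∞) : ℝ≥0∞) : EReal) ∧
    -- agnostic setting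
    (((((min (pSetLittlestoneDim 2 (hammingBalls K q) H) (2 * T) : ℕ∞) : ℝ≥0∞) * T / 8) ^
        (1 / 2 : ℝ) : ℝ≥0∞) : EReal) ≤ minimaxRegret (hammingBalls K q) H T ∧
    minimaxRegret (hammingBalls K q) H T ≤
        (((setLittlestoneDim (hammingBalls K q) H : ℕ∞) +
          (2 * (setLittlestoneDim (hammingBalls K q) H : ℕ∞) * T *
            ENNReal.ofReal (Real.log T)) ^ (1 / 2 : ℝ) : ℝ≥0∞) : EReal) := by
  have hS : ∀ y : Fin K → Bool, ∃ s ∈ hammingBalls K q, y ∈ s := fun y =>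
    ⟨hammingBall y q, ⟨y, rfl⟩, mem_hammingBall_self y q⟩
  -- Capping by the horizon makes the dimension a natural number even when it is infinite.
  have hpair (n : ℕ) : ∃ d : ℕ, min (pSetLittlestoneDim 2 (hammingBalls K q) H) n = d ∧ d ≤ n ∧
      PairShatters (hammingBalls K q) d H := by
    obtain ⟨d, hd⟩ := ENat.ne_top_iff_exists.1
      (ne_top_of_le_ne_top (ENat.natCast_ne_top n)
        (min_le_right (pSetLittlestoneDim 2 (hammingBalls K q) H) n))
    refine ⟨d, hd.symm, ?_, pairShatters_of_le_pSetLittlestoneDim hH (hd ▸ min_le_left _ _)⟩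
    exact_mod_cast hd.trans_le (min_le_right _ _)
  have hcoe (r : ℝ) (hr : 0 ≤ r) : ((ENNReal.ofReal r : ℝ≥0∞) : EReal) = r := by
    rw [EReal.coe_ennreal_ofReal, max_eq_left hr]
  refine ⟨?_, ?_, ?_, ?_⟩
  · obtain ⟨d, hd, hdT, hsh⟩ := hpair T
    convert half_le_minimaxMistakes hS hdT hsh using 1
    rw [hd, ← hcoe _ (by positivity), ENNReal.ofReal_div_of_pos two_pos]
    simp
  · rcases eq_or_ne (setLittlestoneDim (hammingBalls K q) H) ⊤ with htop | htop
    · simp [htop]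
    · obtain ⟨d, hd⟩ := ENat.ne_top_iff_exists.1 htop
      convert minimaxMistakes_le_of_not_setShatters
        (not_setShatters_of_setLittlestoneDim hd.symm) T using 1
      rw [← hd, ← hcoe _ (by positivity)]
      simp
  · obtain ⟨d, hd, hdT, hsh⟩ := hpair (2 * T)
    convert sqrt_le_minimaxRegret hS hdT hsh using 1
    push_cast at hd
    rw [hd, ← hcoe _ (by positivity), Real.sqrt_eq_rpow,
      ← ENNReal.ofReal_rpow_of_nonneg (by positivity) (by positivity),
      ENNReal.ofReal_div_of_pos (by positivity), ENNReal.ofReal_mul (by positivity)]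
    simp
  · rcases eq_or_ne (setLittlestoneDim (hammingBalls K q) H) ⊤ with htop | htop
    · simp [htop]
    · obtain ⟨d, hd⟩ := ENat.ne_top_iff_exists.1 htop
      convert minimaxRegret_le_of_not_setShatters hH
        (not_setShatters_of_setLittlestoneDim hd.symm) T using 1
      have hlog : 0 ≤ Real.log T := Real.log_natCast_nonneg T
      rw [← hd, ← hcoe _ (by positivity), ENNReal.ofReal_add (by positivity) (by positivity),
        Real.sqrt_eq_rpow, ← ENNReal.ofReal_rpow_of_nonneg (by positivity) (by positivity),
        ENNReal.ofReal_mul (by positivity), ENNReal.ofReal_mul (by positivity),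
        ENNReal.ofReal_mul (by positivity)]
      simp
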